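/- There are absolute constants $C, c > 0$ such that the following holds. Let $a_1,\dots,a_m$ be independent standard Gaussian random vectors in $\mathbb{R}^n$, let $K$ be a subset of the closed unit Euclidean ball of $\mathbb{R}^n$, and fix $x \in K$ with $\|x\|_2 = 1$. Let $y_1,\dots,y_m$ be $\{-1,1\}$-valued random variables that are conditionally independent given $(a_1,\dots,a_m)$ and satisfy $$\mathbb{E}\big[y_i \mid a_1,\dots,a_m\big] = \theta(\langle a_i, x\rangle) \quad \text{almost surely}, \qquad i = 1,\dots,m,$$ for some function $\theta:\mathbb{R}\to\mathbb{R}$ with $\lambda := \mathbb{E}[\theta(g)\, g] > 0$, where $g$ is a standard normal random variable. Let $$w(K) := \mathbb{E} \sup_{z \in K - K} \langle \mathbf{g}, z\rangle$$ be the mean width of $K$, where $\mathbf{g}$ is a standard Gaussian random vector in $\mathbb{R}^n$ and $K-K=\{u-v : u,v\in K\}$. Let $\delta > 0$ and suppose that $m \ge C \delta^{-2} w(K)^2$. Then, with probability at least $1 - 8\exp(-c\,\delta^2 m)$, every solution $\hat{x}$ of the optimization problem $$\max \sum_{i=1}^m y_i \langle a_i, x'\rangle \quad \text{subject to} \quad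 x' \in K$$ satisfies $$\|\hat{x} - x\|_2^2 \le \delta/\lambda.$$ -/

import Mathlib

open MeasureTheory ProbabilityTheory
open scoped Pointwise

/-- The (Gaussian) mean width `w(K) = 𝔼 sup_{z ∈ K - K} ⟨g, z⟩`, with `g` a standard Gaussian
vector in `ℝⁿ` and `K - K` the Minkowski difference. -/
noncomputable def meanWidth {n : ℕ} (K : Set (EuclideanSpace ℝ (Fin n))) : ℝ :=
  ∫ g, sSup ((fun z => inner ℝ g z) '' (K - K)) ∂(stdGaussian (EuclideanSpace ℝ (Fin n)))

/-- The correlation coefficient `𝔼 θ(g) g`, with `g` a standard normal variable. -/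
noncomputable def correlation (θ : ℝ → ℝ) : ℝ :=
  ∫ z, θ z * z ∂(gaussianReal 0 1)

/-- The σ-algebra generated by the measurement vectors `a₁, …, aₘ` jointly. -/
abbrev sigmaOf {Ω : Type*} {n m : ℕ} (a : Fin m → Ω → EuclideanSpace ℝ (Fin n)) :
    MeasurableSpace Ω :=
  MeasurableSpace.comap (fun ω i => a i ω) inferInstance

/-- Mutual conditional independence of the real random variables `y i` given the sub-σ-algebra `𝓖`:
`ℙ(⋂_{i ∈ S} {y i ∈ B i} | 𝓖) = ∏_{i ∈ S} ℙ(y i ∈ B i | 𝓖)` almost surely, for all finite `S` and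
all Borel sets `B i`. Unlike Mathlib's `iCondIndepFun`, this does not require the sample space to
be standard Borel. -/
def CondIndepGiven {Ω ι : Type*} (𝓖 : MeasurableSpace Ω) [MeasurableSpace Ω] (μ : Measure Ω)
    (y : ι → Ω → ℝ) : Prop :=
  ∀ (S : Finset ι) (B : ι → Set ℝ), (∀ i ∈ S, MeasurableSet (B i)) →
    μ[(⋂ i ∈ S, y i ⁻¹' B i).indicator (fun _ => (1 : ℝ)) | 𝓖] =ᵐ[μ]
      fun ω => ∏ i ∈ S, (μ[(y i ⁻¹' B i).indicator (fun _ => (1 : ℝ)) | 𝓖]) ω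

/-- The one-bit measurement model for the signal `x` with response function `θ`: independent
standard Gaussian measurement vectors `a i`, and `{-1, 1}`-valued responses `y i` that are
independent given all the `a j`, with conditional mean `θ ⟨a i, x⟩`. -/
structure OneBitModel {Ω : Type*} [MeasurableSpace Ω] (μ : Measure Ω) {n m : ℕ}
    (a : Fin m → Ω → EuclideanSpace ℝ (Fin n)) (y : Fin m → Ω → ℝ)
    (θ : ℝ → ℝ) (x : EuclideanSpace ℝ (Fin n)) : Prop where
  measurable_a : ∀ i, Measurable (a i)
  measurable_y : ∀ i, Measurable (y i)
  gaussian : ∀ i, HasLaw (a i) (stdGaussian (EuclideanSpace ℝ (Fin n))) μ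
  indep : iIndepFun a μ
  sign_valued : ∀ i, ∀ᵐ ω ∂μ, y i ω = -1 ∨ y i ω = 1
  condIndep : CondIndepGiven (sigmaOf a) μ y
  condMean : ∀ i, μ[y i | sigmaOf a] =ᵐ[μ] fun ω => θ (inner ℝ (a i ω) x)

/-- `xhat` solves the program: maximize `∑ i, b i * ⟨v i, x'⟩` subject to `x' ∈ K`. -/
def IsSolution {n m : ℕ} (K : Set (EuclideanSpace ℝ (Fin n)))
    (v : Fin m → EuclideanSpace ℝ (Fin n)) (b : Fin m → ℝ)
    (xhat : EuclideanSpace ℝ (Fin n)) : Prop :=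
  xhat ∈ K ∧ ∀ x' ∈ K, ∑ i, b i * inner ℝ (v i) x' ≤ ∑ i, b i * inner ℝ (v i) xhat

/-!
Testing the optimality of `xhat` against `x` gives
`λ m ‖xhat - x‖² / 2 ≤ h (∑ i, (y i • a i - λ • x))`, where `h` is the support function of `K - K`.
Conditional independence makes the vectors `y i • a i` independent, and they have mean `λ • x` since
the reflection in the line through `x` preserves the Gaussian measure. As `y i • a i = ± a i`,
symmetrization bounds each centered summand by `2 • a i` in the convex order, and hence the sum by
`(2 √m) • g` with `g` standard Gaussian. So the exponential moments of `h` of the sum are at most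
those of `2 √m h(g)`, whose mean is `2 √m w(K)`. The latter are controlled by the Maurey–Pisier
argument: rotating one Gaussian copy into an independent one writes the increment of a Lipschitz
function as an average over time of its derivative, paired at each time with an independent
Gaussian vector.
-/

theorem ofReal_map_integral_le_lintegral {α E : Type*} [MeasurableSpace α] {μ : Measure α}
    [IsProbabilityMeasure μ] [NormedAddCommGroup E] [NormedSpace ℝ E] [FiniteDimensional ℝ E]
    {Φ : E → ℝ} (hΦ : ConvexOn ℝ Set.univ Φ) (hΦ0 : ∀ x, 0 ≤ Φ x) {f : α → E}
    (hf : Integrable f μ) :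
    ENNReal.ofReal (Φ (∫ ω, f ω ∂μ)) ≤ ∫⁻ ω, ENNReal.ofReal (Φ (f ω)) ∂μ := by
  have hcont : Continuous Φ := hΦ.locallyLipschitz.continuous
  have hmeas : AEStronglyMeasurable (fun ω => Φ (f ω)) μ :=
    hcont.comp_aestronglyMeasurable hf.aestronglyMeasurable
  by_cases hfin : ∫⁻ ω, ENNReal.ofReal (Φ (f ω)) ∂μ = ⊤
  · exact hfin ▸ le_top
  have hint : Integrable (fun ω => Φ (f ω)) μ :=
    (lintegral_ofReal_ne_top_iff_integrable hmeas (ae_of_all _ fun ω => hΦ0 _)).1 hfin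
  rw [← ofReal_integral_eq_lintegral_ofReal hint (ae_of_all _ fun ω => hΦ0 _)]
  exact ENNReal.ofReal_le_ofReal <| hΦ.map_integral_le hcont.continuousOn isClosed_univ
    (ae_of_all _ fun _ => Set.mem_univ _) hf hint

theorem absolutelyContinuous_pi {n : ℕ} {α : Fin n → Type*} [∀ i, MeasurableSpace (α i)]
    {μ ν : ∀ i, Measure (α i)} [∀ i, SigmaFinite (μ i)] [∀ i, SigmaFinite (ν i)]
    (h : ∀ i, μ i ≪ ν i) : Measure.pi μ ≪ Measure.pi ν := by
  induction n with
  | zero => rw [Measure.pi_of_empty, Measure.pi_of_empty]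
  | succ n ih =>
    rw [← (measurePreserving_piFinSuccAbove μ 0).symm.map_eq,
      ← (measurePreserving_piFinSuccAbove ν 0).symm.map_eq]
    exact ((h 0).prod (ih fun i => h _)).map (MeasurableEquiv.measurable _)

section AbsoluteContinuity

variable {E : Type*} [NormedAddCommGroup E] [InnerProductSpace ℝ E] [FiniteDimensional ℝ E]
  [MeasurableSpace E] [BorelSpace E]

theorem stdGaussian_absolutelyContinuous : stdGaussian E ≪ volume := by
  have hpi := absolutelyContinuous_pi (n := Module.finrank ℝ E)
    fun _ => gaussianReal_absolutelyContinuous 0 one_ne_zero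
  have h := (hpi.map (f := WithLp.toLp 2) (by fun_prop)).map
    (stdOrthonormalBasis ℝ E).measurePreserving_repr_symm.measurable
  rwa [map_pi_eq_stdGaussian, stdGaussian_map, ← volume_pi,
    (PiLp.volume_preserving_toLp _).map_eq,
    (stdOrthonormalBasis ℝ E).measurePreserving_repr_symm.map_eq] at h

theorem ae_differentiableAt_stdGaussian {F : E → ℝ} {L : NNReal} (hF : LipschitzWith L F) :
    ∀ᵐ x ∂stdGaussian E, DifferentiableAt ℝ F x :=
  stdGaussian_absolutelyContinuous.ae_le hF.ae_differentiableAt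

end AbsoluteContinuity

section QuarterTurn

variable {E : Type*} [NormedAddCommGroup E] [NormedSpace ℝ E]

/-- The path `t ↦ (cos (π t / 2) p₁ + sin (π t / 2) p₂, -sin (π t / 2) p₁ + cos (π t / 2) p₂)`,
whose first component joins `p₁` to `p₂` over the time interval `[0, 1]`. -/
noncomputable def quarterTurn (p : E × E) (t : ℝ) : E × E :=
  ContinuousLinearMap.rotation (Real.pi / 2 * t) p

theorem continuous_quarterTurn : Continuous fun q : (E × E) × ℝ => quarterTurn q.1 q.2 := by
  simp only [quarterTurn, ContinuousLinearMap.rotation_apply]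
  fun_prop

theorem contDiff_quarterTurn_fst (p : E × E) : ContDiff ℝ 1 fun t => (quarterTurn p t).1 := by
  simp only [quarterTurn, ContinuousLinearMap.rotation_apply]
  fun_prop

theorem hasDerivAt_quarterTurn_fst (p : E × E) (t : ℝ) :
    HasDerivAt (fun t => (quarterTurn p t).1) ((Real.pi / 2) • (quarterTurn p t).2) t := by
  have hlin : HasDerivAt (fun t : ℝ => Real.pi / 2 * t) (Real.pi / 2) t :=
    hasDerivAt_const_mul (Real.pi / 2)
  simp only [quarterTurn, ContinuousLinearMap.rotation_apply]
  convert! (hlin.cos.smul_const p.1).add (hlin.sin.smul_const p.2) using 1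
  module

theorem absolutelyContinuousOnInterval_comp_quarterTurn_fst {F : E → ℝ} {L : NNReal}
    (hF : LipschitzWith L F) (p : E × E) (a b : ℝ) :
    AbsolutelyContinuousOnInterval (fun t => F (quarterTurn p t).1) a b :=
  have hloc : LocallyLipschitz fun t => F (quarterTurn p t).1 :=
    hF.locallyLipschitz.comp (contDiff_quarterTurn_fst p).locallyLipschitz
  have ⟨_, hlip⟩ := hloc.locallyLipschitzOn.exists_lipschitzOnWith_of_compact isCompact_uIcc
  hlip.absolutelyContinuousOnInterval

theorem ofReal_exp_sub_le_lintegral_quarterTurn {F : E → ℝ} {L : NNReal} (hF : LipschitzWith L F)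
    {p : E × E} (s : ℝ)
    (hp : ∀ᵐ t ∂volume.restrict (Set.Ioc (0 : ℝ) 1), DifferentiableAt ℝ F (quarterTurn p t).1) :
    ENNReal.ofReal (Real.exp (s * (F p.2 - F p.1))) ≤
      ∫⁻ t in Set.Ioc (0 : ℝ) 1, ENNReal.ofReal (Real.exp
        (s * (Real.pi / 2) * fderiv ℝ F (quarterTurn p t).1 (quarterTurn p t).2)) := by
  have : IsProbabilityMeasure (volume.restrict (Set.Ioc (0 : ℝ) 1)) := ⟨by simp⟩
  have hac := absolutelyContinuousOnInterval_comp_quarterTurn_fst hF p 0 1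
  have hftc : s * (F p.2 - F p.1) =
      ∫ t in Set.Ioc (0 : ℝ) 1, s * deriv (fun t => F (quarterTurn p t).1) t := by
    rw [integral_const_mul, ← intervalIntegral.integral_of_le zero_le_one,
      hac.integral_deriv_eq_sub]
    simp [quarterTurn, ContinuousLinearMap.rotation_apply]
  rw [hftc]
  refine (ofReal_map_integral_le_lintegral convexOn_exp (fun x => (Real.exp_pos x).le)
    (hac.intervalIntegrable_deriv.1.const_mul s)).trans_eq (lintegral_congr_ae ?_)
  filter_upwards [hp] with t ht
  have hderiv : HasDerivAt (fun t => F (quarterTurn p t).1) _ t :=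
    ht.hasFDerivAt.comp_hasDerivAt t (hasDerivAt_quarterTurn_fst p t)
  rw [hderiv.deriv, map_smul, smul_eq_mul, mul_assoc]

end QuarterTurn

section GaussianConcentration

variable {E : Type*} [NormedAddCommGroup E] [InnerProductSpace ℝ E] [FiniteDimensional ℝ E]
  [MeasurableSpace E] [BorelSpace E]

theorem measurePreserving_quarterTurn (t : ℝ) :
    MeasurePreserving (fun p : E × E => quarterTurn p t) ((stdGaussian E).prod (stdGaussian E))
      ((stdGaussian E).prod (stdGaussian E)) where
  measurable := (continuous_quarterTurn.comp (.prodMk_left t)).measurable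
  map_eq := IsGaussian.map_rotation_eq_self (by simp) _

theorem map_strongDual_stdGaussian (l : StrongDual ℝ E) :
    (stdGaussian E).map l = gaussianReal 0 (‖l‖ ^ 2).toNNReal := by
  rw [IsGaussian.map_eq_gaussianReal, integral_strongDual_stdGaussian, variance_dual_stdGaussian]

theorem lintegral_exp_strongDual_stdGaussian (l : StrongDual ℝ E) :
    ∫⁻ y, ENNReal.ofReal (Real.exp (l y)) ∂stdGaussian E =
      ENNReal.ofReal (Real.exp (‖l‖ ^ 2 / 2)) := by
  have hint : Integrable (fun y => Real.exp (l y)) (stdGaussian E) := by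
    have h := integrable_exp_mul_gaussianReal (μ := 0) (v := (‖l‖ ^ 2).toNNReal) 1
    rw [← map_strongDual_stdGaussian, integrable_map_measure (by fun_prop) (by fun_prop)] at h
    simpa only [Function.comp_def, one_mul] using h
  rw [← ofReal_integral_eq_lintegral_ofReal hint (ae_of_all _ fun _ => (Real.exp_pos _).le)]
  have hmgf := mgf_gaussianReal (map_strongDual_stdGaussian l) 1
  simp only [mgf, one_mul, zero_add, one_pow, mul_one,
    Real.coe_toNNReal _ (sq_nonneg ‖l‖)] at hmgf
  rw [hmgf]

theorem measurable_fderiv_apply (F : E → ℝ) : Measurable fun p : E × E => fderiv ℝ F p.1 p.2 :=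
  isBoundedBilinearMap_apply.continuous.measurable.comp
    (((measurable_fderiv ℝ F).comp measurable_fst).prodMk measurable_snd)

theorem lintegral_exp_fderiv_stdGaussian_le {F : E → ℝ} {L : NNReal} (hF : LipschitzWith L F)
    (r : ℝ) :
    ∫⁻ p, ENNReal.ofReal (Real.exp (r * fderiv ℝ F p.1 p.2))
        ∂(stdGaussian E).prod (stdGaussian E) ≤
      ENNReal.ofReal (Real.exp (r ^ 2 * L ^ 2 / 2)) := by
  have hmeas := measurable_fderiv_apply F
  have hinner (x : E) : ∫⁻ y, ENNReal.ofReal (Real.exp (r * fderiv ℝ F x y)) ∂stdGaussian E ≤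
      ENNReal.ofReal (Real.exp (r ^ 2 * L ^ 2 / 2)) := by
    refine (lintegral_exp_strongDual_stdGaussian (r • fderiv ℝ F x)).trans_le ?_
    rw [norm_smul, mul_pow, Real.norm_eq_abs, sq_abs]
    gcongr
    exact norm_fderiv_le_of_lipschitz ℝ hF
  rw [lintegral_prod _ (by fun_prop)]
  simpa using lintegral_mono (μ := stdGaussian E) hinner

theorem ae_ae_differentiableAt_quarterTurn {F : E → ℝ} {L : NNReal} (hF : LipschitzWith L F) :
    ∀ᵐ p ∂(stdGaussian E).prod (stdGaussian E), ∀ᵐ t ∂volume.restrict (Set.Ioc (0 : ℝ) 1),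
      DifferentiableAt ℝ F (quarterTurn p t).1 := by
  have hmeas : MeasurableSet {q : (E × E) × ℝ | DifferentiableAt ℝ F (quarterTurn q.1 q.2).1} :=
    continuous_quarterTurn.fst.measurable (measurableSet_of_differentiableAt ℝ F)
  rw [Measure.ae_ae_comm hmeas]
  refine ae_of_all _ fun t => ?_
  exact (Measure.quasiMeasurePreserving_fst.comp
    (measurePreserving_quarterTurn t).quasiMeasurePreserving).ae
      (ae_differentiableAt_stdGaussian hF)

theorem lintegral_exp_sub_stdGaussian_le {F : E → ℝ} {L : NNReal} (hF : LipschitzWith L F)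
    (s : ℝ) :
    ∫⁻ p, ENNReal.ofReal (Real.exp (s * (F p.2 - F p.1)))
        ∂(stdGaussian E).prod (stdGaussian E) ≤
      ENNReal.ofReal (Real.exp (s ^ 2 * (Real.pi ^ 2 / 8 * L ^ 2))) := by
  set G : E × E → ENNReal := fun p =>
    ENNReal.ofReal (Real.exp (s * (Real.pi / 2) * fderiv ℝ F p.1 p.2))
  have hG : Measurable G :=
    ((measurable_fderiv_apply F).const_mul _).exp.ennreal_ofReal
  calc ∫⁻ p, ENNReal.ofReal (Real.exp (s * (F p.2 - F p.1)))
        ∂(stdGaussian E).prod (stdGaussian E)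
      ≤ ∫⁻ p, (∫⁻ t in Set.Ioc (0 : ℝ) 1, G (quarterTurn p t))
        ∂(stdGaussian E).prod (stdGaussian E) := by
        refine lintegral_mono_ae ?_
        filter_upwards [ae_ae_differentiableAt_quarterTurn hF] with p hp
        exact ofReal_exp_sub_le_lintegral_quarterTurn hF s hp
    _ = ∫⁻ t in Set.Ioc (0 : ℝ) 1, ∫⁻ p, G (quarterTurn p t)
        ∂(stdGaussian E).prod (stdGaussian E) :=
      lintegral_lintegral_swap (f := fun p t => G (quarterTurn p t))
        (hG.comp continuous_quarterTurn.measurable).aemeasurable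
    _ = ∫⁻ p, G p ∂(stdGaussian E).prod (stdGaussian E) := by
      simp_rw [(measurePreserving_quarterTurn _).lintegral_comp hG]
      simp
    _ ≤ ENNReal.ofReal (Real.exp ((s * (Real.pi / 2)) ^ 2 * L ^ 2 / 2)) :=
      lintegral_exp_fderiv_stdGaussian_le hF _
    _ = ENNReal.ofReal (Real.exp (s ^ 2 * (Real.pi ^ 2 / 8 * L ^ 2))) := by ring_nf

theorem integrable_of_lipschitzWith {F : E → ℝ} {L : NNReal} (hF : LipschitzWith L F)
    (μ : Measure E) [IsGaussian μ] : Integrable F μ := by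
  have hbound : Integrable (fun x => ‖F 0‖ + L * ‖x‖) μ :=
    (integrable_const _).add (IsGaussian.integrable_id.norm.const_mul _)
  refine hbound.mono' hF.continuous.aestronglyMeasurable (ae_of_all _ fun x => ?_)
  have hlip : ‖F x - F 0‖ ≤ L * ‖x - 0‖ := hF.norm_sub_le x 0
  rw [sub_zero] at hlip
  exact (norm_le_norm_add_norm_sub' _ _).trans (add_le_add_right hlip _)

theorem lintegral_exp_sub_integral_stdGaussian_le {F : E → ℝ} {L : NNReal}
    (hF : LipschitzWith L F) (s : ℝ) :
    ∫⁻ y, ENNReal.ofReal (Real.exp (s * (F y - ∫ x, F x ∂stdGaussian E))) ∂stdGaussian E ≤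
      ENNReal.ofReal (Real.exp (s ^ 2 * (Real.pi ^ 2 / 8 * L ^ 2))) := by
  have hint := integrable_of_lipschitzWith hF (stdGaussian E)
  have hcont := hF.continuous
  refine le_trans ?_ (lintegral_exp_sub_stdGaussian_le hF s)
  rw [lintegral_prod_symm _ (by fun_prop)]
  refine lintegral_mono fun y => ?_
  have hshift : s * (F y - ∫ x, F x ∂stdGaussian E) = ∫ x, s * (F y - F x) ∂stdGaussian E := by
    rw [integral_const_mul, integral_sub (integrable_const _) hint]
    simp
  rw [hshift]
  exact ofReal_map_integral_le_lintegral convexOn_exp (fun x => (Real.exp_pos x).le)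
    (((integrable_const _).sub hint).const_mul s)

end GaussianConcentration

section ConvexOrder

variable {E : Type*} [NormedAddCommGroup E] [NormedSpace ℝ E] [FiniteDimensional ℝ E]
  [MeasurableSpace E] [BorelSpace E]

/-- The convex order `ν ≼ ν'` of two laws: `∫ Φ dν ≤ ∫ Φ dν'` for every convex `Φ`. Only
nonnegative `Φ` are tested, so that Lebesgue integrals with values in `[0, ∞]` can be used and no
integrability is required. -/
def ConvexDominated (ν ν' : Measure E) : Prop :=
  ∀ Φ : E → ℝ, ConvexOn ℝ Set.univ Φ → (∀ x, 0 ≤ Φ x) →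
    ∫⁻ x, ENNReal.ofReal (Φ x) ∂ν ≤ ∫⁻ x, ENNReal.ofReal (Φ x) ∂ν'

theorem measurable_ofReal_of_convexOn {Φ : E → ℝ} (hΦ : ConvexOn ℝ Set.univ Φ) :
    Measurable fun x => ENNReal.ofReal (Φ x) :=
  hΦ.locallyLipschitz.continuous.measurable.ennreal_ofReal

theorem ConvexDominated.conv_left {ν ν' : Measure E} [SFinite ν] [SFinite ν']
    (h : ConvexDominated ν ν') (ρ : Measure E) : ConvexDominated (ρ ∗ ν) (ρ ∗ ν') := by
  intro Φ hΦ hΦ0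
  have hmeas := measurable_ofReal_of_convexOn hΦ
  rw [Measure.lintegral_conv hmeas, Measure.lintegral_conv hmeas]
  refine lintegral_mono fun x => h (fun y => Φ (x + y)) ?_ fun y => hΦ0 _
  exact hΦ.translate_right x

theorem ConvexDominated.conv {ν₁ ν₁' ν₂ ν₂' : Measure E} [SFinite ν₁] [SFinite ν₁'] [SFinite ν₂]
    [SFinite ν₂'] (h₁ : ConvexDominated ν₁ ν₁') (h₂ : ConvexDominated ν₂ ν₂') :
    ConvexDominated (ν₁ ∗ ν₂) (ν₁' ∗ ν₂') := by
  intro Φ hΦ hΦ0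
  refine (h₂.conv_left ν₁ Φ hΦ hΦ0).trans ?_
  rw [Measure.conv_comm ν₁, Measure.conv_comm ν₁']
  exact h₁.conv_left ν₂' Φ hΦ hΦ0

variable {Ω : Type*} [MeasurableSpace Ω] {μ : Measure Ω} [IsProbabilityMeasure μ]

-- `X - 𝔼 X` is the midpoint of `2 X` and `-2 𝔼 X`, and Jensen applies to the latter.
theorem lintegral_comp_sub_integral_le {Φ : E → ℝ} (hΦ : ConvexOn ℝ Set.univ Φ) (hΦ0 : ∀ x, 0 ≤ Φ x)
    {X : Ω → E} (hX : Integrable X μ) :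
    ∫⁻ ω, ENNReal.ofReal (Φ (X ω - ∫ ω', X ω' ∂μ)) ∂μ ≤
      ∫⁻ ω, (ENNReal.ofReal (1 / 2 * Φ ((2 : ℝ) • X ω)) +
        ENNReal.ofReal (1 / 2 * Φ (-(2 : ℝ) • X ω))) ∂μ := by
  have hneg : ConvexOn ℝ Set.univ fun v => Φ (-(2 : ℝ) • v) :=
    hΦ.comp_linearMap (LinearMap.lsmul ℝ E (-2))
  have hpt (ω : Ω) : Φ (X ω - ∫ ω', X ω' ∂μ) ≤
      1 / 2 * Φ ((2 : ℝ) • X ω) + 1 / 2 * Φ (-(2 : ℝ) • ∫ ω', X ω' ∂μ) := by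
    have h := hΦ.2 (Set.mem_univ ((2 : ℝ) • X ω)) (Set.mem_univ (-(2 : ℝ) • ∫ ω', X ω' ∂μ))
      one_half_pos.le one_half_pos.le (add_halves (1 : ℝ))
    refine le_of_eq_of_le (congrArg Φ ?_) h
    module
  have hmeas : AEMeasurable (fun ω => ENNReal.ofReal (1 / 2 * Φ ((2 : ℝ) • X ω))) μ := by
    have := hΦ.locallyLipschitz.continuous
    have := hX.aemeasurable
    fun_prop
  calc ∫⁻ ω, ENNReal.ofReal (Φ (X ω - ∫ ω', X ω' ∂μ)) ∂μ
      ≤ ∫⁻ ω, (ENNReal.ofReal (1 / 2 * Φ ((2 : ℝ) • X ω)) +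
          ENNReal.ofReal (1 / 2 * Φ (-(2 : ℝ) • ∫ ω', X ω' ∂μ))) ∂μ :=
        lintegral_mono fun ω => (ENNReal.ofReal_le_ofReal (hpt ω)).trans ENNReal.ofReal_add_le
    _ = ∫⁻ ω, ENNReal.ofReal (1 / 2 * Φ ((2 : ℝ) • X ω)) ∂μ +
          ENNReal.ofReal (1 / 2 * Φ (-(2 : ℝ) • ∫ ω', X ω' ∂μ)) := by
        rw [lintegral_add_left' hmeas, lintegral_const, measure_univ, mul_one]
    _ ≤ ∫⁻ ω, ENNReal.ofReal (1 / 2 * Φ ((2 : ℝ) • X ω)) ∂μ +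
          ∫⁻ ω, ENNReal.ofReal (1 / 2 * Φ (-(2 : ℝ) • X ω)) ∂μ := by
        gcongr
        exact ofReal_map_integral_le_lintegral (hneg.smul one_half_pos.le)
          (fun v => mul_nonneg one_half_pos.le (hΦ0 _)) hX
    _ = _ := (lintegral_add_left' hmeas _).symm

theorem convexDominated_map_sub_integral {ν : Measure E} [ν.IsNegInvariant] {X a : Ω → E}
    (hX : Integrable X μ) (ha : HasLaw a ν μ) (hXa : ∀ᵐ ω ∂μ, X ω = a ω ∨ X ω = -a ω) :
    ConvexDominated (μ.map fun ω => X ω - ∫ ω', X ω' ∂μ) (ν.map ((2 : ℝ) • ·)) := by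
  intro Φ hΦ hΦ0
  have hcont := hΦ.locallyLipschitz.continuous
  rw [lintegral_map' (measurable_ofReal_of_convexOn hΦ).aemeasurable (hX.aemeasurable.sub_const _),
    lintegral_map (measurable_ofReal_of_convexOn hΦ) (by fun_prop)]
  set f : E → ENNReal := fun v => ENNReal.ofReal (1 / 2 * Φ ((2 : ℝ) • v)) with hf
  have hfm : Measurable f := by fun_prop
  calc ∫⁻ ω, ENNReal.ofReal (Φ (X ω - ∫ ω', X ω' ∂μ)) ∂μ
      ≤ ∫⁻ ω, (f (X ω) + f (-X ω)) ∂μ := by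
        simpa only [hf, smul_neg, neg_smul] using lintegral_comp_sub_integral_le hΦ hΦ0 hX
    _ = ∫⁻ ω, (f (a ω) + f (-a ω)) ∂μ := by
        refine lintegral_congr_ae ?_
        filter_upwards [hXa] with ω h
        rcases h with h | h
        · rw [h]
        · rw [h, neg_neg, add_comm]
    _ = ∫⁻ v, (f v + f (-v)) ∂ν := ha.lintegral_comp (f := fun v => f v + f (-v)) (by fun_prop)
    _ = ∫⁻ v, f v ∂ν + ∫⁻ v, f v ∂ν := by
        rw [lintegral_add_left hfm, lintegral_neg_eq_self]
    _ = ∫⁻ v, ENNReal.ofReal (Φ ((2 : ℝ) • v)) ∂ν := by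
        rw [← lintegral_add_left hfm]
        refine lintegral_congr fun v => ?_
        rw [← ENNReal.ofReal_add (mul_nonneg one_half_pos.le (hΦ0 _))
          (mul_nonneg one_half_pos.le (hΦ0 _)), ← add_mul, add_halves, one_mul]

end ConvexOrder

section GaussianDomination

variable {E : Type*} [NormedAddCommGroup E] [InnerProductSpace ℝ E] [FiniteDimensional ℝ E]
  [MeasurableSpace E] [BorelSpace E]

theorem map_smul_stdGaussian_conv (r₁ r₂ : ℝ) :
    (stdGaussian E).map (r₁ • ·) ∗ (stdGaussian E).map (r₂ • ·) =
      (stdGaussian E).map (√(r₁ ^ 2 + r₂ ^ 2) • ·) := by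
  refine Measure.ext_of_charFun (funext fun t => ?_)
  simp only [charFun_conv, charFun_map_smul, charFun_stdGaussian, norm_smul, ← Complex.exp_add,
    Real.norm_eq_abs, Complex.ofReal_mul, mul_pow, ← Complex.ofReal_pow, sq_abs]
  rw [Real.sq_sqrt (by positivity)]
  push_cast
  ring_nf

variable {Ω ι : Type*} [MeasurableSpace Ω] {μ : Measure Ω}

theorem convexDominated_map_sum [IsProbabilityMeasure μ] {Y : ι → Ω → E} {r : ι → ℝ}
    (hY : ∀ i, Measurable (Y i)) (hind : iIndepFun Y μ)
    (hdom : ∀ i, ConvexDominated (μ.map (Y i)) ((stdGaussian E).map (r i • ·))) (s : Finset ι) :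
    ConvexDominated (μ.map (∑ i ∈ s, Y i)) ((stdGaussian E).map (√(∑ i ∈ s, r i ^ 2) • ·)) := by
  classical
  induction s using Finset.induction_on with
  | empty =>
    intro Φ _ _
    simp [Pi.zero_def]
  | insert j s hj ih =>
    have hsum : Measurable (∑ i ∈ s, Y i) := by
      simpa only [Finset.sum_fn] using Finset.measurable_sum s fun i _ => hY i
    have hindep := (hind.indepFun_finsetSum_of_notMem hY hj).symm
    rw [Finset.sum_insert hj, hindep.map_add_eq_map_conv_map (hY j) hsum]
    have hconv := (hdom j).conv ih
    rwa [map_smul_stdGaussian_conv, Real.sq_sqrt (Finset.sum_nonneg fun i _ => sq_nonneg (r i)),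
      ← Finset.sum_insert (f := fun i => r i ^ 2) hj] at hconv

instance isNegInvariant_stdGaussian : (stdGaussian E).IsNegInvariant :=
  ⟨stdGaussian_map (LinearIsometryEquiv.neg ℝ)⟩

theorem measureReal_ge_le_of_lintegral_exp_le {Z : Ω → ℝ} {v u : ℝ} (hZ : AEMeasurable Z μ)
    (hv : 0 ≤ v) (hu : 0 ≤ u)
    (h : ∀ s, 0 ≤ s → ∫⁻ ω, ENNReal.ofReal (Real.exp (s * Z ω)) ∂μ ≤
      ENNReal.ofReal (Real.exp (s ^ 2 * v))) :
    μ.real {ω | u ≤ Z ω} ≤ Real.exp (-(u ^ 2 / (4 * v))) := by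
  set s := u / (2 * v)
  have hs : 0 ≤ s := by positivity
  have hsubset : {ω | u ≤ Z ω} ⊆
      {ω | ENNReal.ofReal (Real.exp (s * u)) ≤ ENNReal.ofReal (Real.exp (s * Z ω))} := by
    intro ω hω
    have hω : u ≤ Z ω := hω
    change ENNReal.ofReal _ ≤ ENNReal.ofReal _
    gcongr
  have hmarkov : μ {ω | u ≤ Z ω} ≤
      ENNReal.ofReal (Real.exp (s ^ 2 * v)) / ENNReal.ofReal (Real.exp (s * u)) :=
    (measure_mono hsubset).trans <| (meas_ge_le_lintegral_div (by fun_prop)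
      (by simpa using Real.exp_pos _) ENNReal.ofReal_ne_top).trans <|
      ENNReal.div_le_div_right (h s hs) _
  rw [← ENNReal.ofReal_div_of_pos (Real.exp_pos _), ← Real.exp_sub] at hmarkov
  refine (ENNReal.toReal_le_of_le_ofReal (Real.exp_pos _).le hmarkov).trans_eq ?_
  congr 1
  rcases hv.eq_or_lt with rfl | hv
  · simp [s]
  · simp only [s]
    field_simp
    ring

theorem convexOn_exp_comp {V : Type*} [AddCommGroup V] [Module ℝ V] {f : V → ℝ} {S : Set V}
    (hf : ConvexOn ℝ S f) : ConvexOn ℝ S fun x => Real.exp (f x) :=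
  ⟨hf.1, fun _ hx _ hy _ _ ha hb hab => (Real.exp_le_exp.2 (hf.2 hx hy ha hb hab)).trans
    (convexOn_exp.2 (Set.mem_univ _) (Set.mem_univ _) ha hb hab)⟩

theorem measureReal_ge_le_of_convexDominated {Z : Ω → E} (hZ : AEMeasurable Z μ) {r : ℝ}
    (hdom : ConvexDominated (μ.map Z) ((stdGaussian E).map (r • ·))) {F : E → ℝ} {L : NNReal}
    (hF : LipschitzWith L F) (hFc : ConvexOn ℝ Set.univ F) {u : ℝ} (hu : 0 ≤ u) :
    μ.real {ω | ∫ g, F (r • g) ∂stdGaussian E + u ≤ F (Z ω)} ≤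
      Real.exp (-(2 * u ^ 2 / (Real.pi * L * r) ^ 2)) := by
  set M := ∫ g, F (r • g) ∂stdGaussian E
  have hFr : LipschitzWith (L * ‖r‖₊) fun g => F (r • g) := hF.comp (lipschitzWith_smul r)
  have hcont := hF.continuous
  have hmgf (s : ℝ) (hs : 0 ≤ s) : ∫⁻ ω, ENNReal.ofReal (Real.exp (s * (F (Z ω) - M))) ∂μ ≤
      ENNReal.ofReal (Real.exp (s ^ 2 * (Real.pi ^ 2 / 8 * (L * ‖r‖₊ : NNReal) ^ 2))) := by
    have hexp : ConvexOn ℝ Set.univ fun x => Real.exp (s * (F x - M)) :=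
      convexOn_exp_comp ((sub_eq_add_neg F _ ▸ hFc.add_const (-M)).smul hs)
    have h := hdom _ hexp fun x => (Real.exp_pos _).le
    rw [lintegral_map' (by fun_prop) hZ, lintegral_map (by fun_prop) (by fun_prop)] at h
    exact h.trans (lintegral_exp_sub_integral_stdGaussian_le hFr s)
  have h := measureReal_ge_le_of_lintegral_exp_le (by fun_prop) (by positivity) hu hmgf
  simp only [le_sub_iff_add_le'] at h
  convert! h using 3
  rw [NNReal.coe_mul, coe_nnnorm, mul_pow _ ‖r‖, Real.norm_eq_abs, sq_abs]
  ring

end GaussianDomination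

theorem sub_self_subset_closedBall {E : Type*} [SeminormedAddCommGroup E] {S : Set E} {r : ℝ}
    (hS : S ⊆ Metric.closedBall 0 r) : S - S ⊆ Metric.closedBall 0 (2 * r) := by
  rintro _ ⟨u, hu, v, hv, rfl⟩
  rw [mem_closedBall_zero_iff, two_mul]
  exact (norm_sub_le u v).trans (add_le_add (mem_closedBall_zero_iff.1 (hS hu))
    (mem_closedBall_zero_iff.1 (hS hv)))

section SupportFunction

variable {E : Type*} [NormedAddCommGroup E] [InnerProductSpace ℝ E]

/-- The support function `u ↦ sup_{z ∈ S} ⟨u, z⟩` of the set `S`. As a supremum of real numbers it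
is only meaningful for nonempty bounded `S`. -/
noncomputable def supportFunction (S : Set E) (u : E) : ℝ :=
  sSup ((fun z => inner ℝ u z) '' S)

variable {S : Set E}

theorem inner_le_supportFunction (hS : Bornology.IsBounded S) (u : E) {z : E} (hz : z ∈ S) :
    inner ℝ u z ≤ supportFunction S u := by
  have hbdd : Bornology.IsBounded ((fun z => inner ℝ u z) '' S) :=
    (innerSL ℝ u).lipschitz.isBounded_image hS
  exact le_csSup hbdd.bddAbove (Set.mem_image_of_mem _ hz)

theorem supportFunction_le (hne : S.Nonempty) {u : E} {M : ℝ} (h : ∀ z ∈ S, inner ℝ u z ≤ M) :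
    supportFunction S u ≤ M :=
  csSup_le (hne.image _) (Set.forall_mem_image.2 h)

theorem supportFunction_add_le (hne : S.Nonempty) (hS : Bornology.IsBounded S) (u v : E) :
    supportFunction S (u + v) ≤ supportFunction S u + supportFunction S v := by
  refine supportFunction_le hne fun z hz => ?_
  rw [inner_add_left]
  exact add_le_add (inner_le_supportFunction hS u hz) (inner_le_supportFunction hS v hz)

theorem supportFunction_smul {c : ℝ} (hc : 0 ≤ c) (S : Set E) (u : E) :
    supportFunction S (c • u) = c * supportFunction S u := by
  have himage : (fun z => inner ℝ (c • u) z) '' S = c • ((fun z => inner ℝ u z) '' S) := by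
    simp only [← Set.image_smul, Set.image_image, real_inner_smul_left, smul_eq_mul]
  rw [supportFunction, himage, Real.sSup_smul_of_nonneg hc, smul_eq_mul, supportFunction]

theorem convexOn_supportFunction (hne : S.Nonempty) (hS : Bornology.IsBounded S) :
    ConvexOn ℝ Set.univ (supportFunction S) := by
  refine ⟨convex_univ, fun u _ v _ a b ha hb _ => ?_⟩
  rw [smul_eq_mul, smul_eq_mul, ← supportFunction_smul ha, ← supportFunction_smul hb]
  exact supportFunction_add_le hne hS _ _

theorem lipschitzWith_supportFunction {L : NNReal} (hne : S.Nonempty)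
    (hS : S ⊆ Metric.closedBall 0 L) : LipschitzWith L (supportFunction S) := by
  refine LipschitzWith.of_le_add_mul L fun u v => supportFunction_le hne fun z hz => ?_
  have hz' : ‖z‖ ≤ L := by simpa using hS hz
  calc inner ℝ u z = inner ℝ v z + inner ℝ (u - v) z := by rw [inner_sub_left, add_sub_cancel]
    _ ≤ supportFunction S v + ‖u - v‖ * ‖z‖ :=
      add_le_add (inner_le_supportFunction (Metric.isBounded_closedBall.subset hS) v hz)
        (real_inner_le_norm _ _)
    _ ≤ supportFunction S v + L * dist u v := by
      rw [dist_eq_norm, mul_comm]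
      gcongr

end SupportFunction

section ConditionalIndependence

variable {Ω ι : Type*} {𝓖 mΩ : MeasurableSpace Ω} {μ : Measure Ω} {α : ι → Type*}
  {a : ∀ i, Ω → α i} {y : ι → Ω → ℝ}

theorem indicator_biInter_preimage_prod (A : ∀ i, Set (α i)) (q : ∀ i, α i → ℝ) (S : Finset ι) :
    (⋂ i ∈ S, a i ⁻¹' A i).indicator (fun ω => ∏ i ∈ S, q i (a i ω)) =
      fun ω => ∏ i ∈ S, (A i).indicator (q i) (a i ω) := by
  ext ω
  by_cases hω : ω ∈ ⋂ i ∈ S, a i ⁻¹' A i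
  · rw [Set.indicator_of_mem hω]
    refine Finset.prod_congr rfl fun i hi => ?_
    have hωi : a i ω ∈ A i := Set.mem_iInter₂.1 hω i hi
    rw [Set.indicator_of_mem hωi]
  · rw [Set.indicator_of_notMem hω]
    obtain ⟨i, hi, hωi⟩ : ∃ i ∈ S, a i ω ∉ A i := by
      simpa only [Set.mem_iInter₂, not_forall, exists_prop, Set.mem_preimage] using hω
    exact (Finset.prod_eq_zero hi (Set.indicator_of_notMem hωi (q i))).symm

variable [∀ i, MeasurableSpace (α i)]

theorem integral_finset_prod_comp_of_iIndepFun {q : ∀ i, α i → ℝ} (ha : ∀ i, Measurable (a i))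
    (hindep : iIndepFun a μ) (hq : ∀ i, Measurable (q i)) (S : Finset ι) :
    ∫ ω, ∏ i ∈ S, q i (a i ω) ∂μ = ∏ i ∈ S, ∫ ω, q i (a i ω) ∂μ := by
  have hS := (hindep.precomp (Subtype.val_injective (p := (· ∈ S)))).integral_fun_prod_comp
    (fun i => (ha i).aemeasurable) fun i => (hq i).aestronglyMeasurable
  simp only [← Finset.prod_coe_sort S]
  exact hS

variable [IsProbabilityMeasure μ]

theorem CondIndepGiven.measureReal_biInter_inter (h : CondIndepGiven 𝓖 μ y) (hle : 𝓖 ≤ mΩ)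
    (ha : ∀ i, Measurable[𝓖] (a i)) (hindep : iIndepFun a μ) (hy : ∀ i, Measurable (y i))
    {A : ∀ i, Set (α i)} {B : ι → Set ℝ} (hA : ∀ i, MeasurableSet (A i))
    (hB : ∀ i, MeasurableSet (B i)) {q : ∀ i, α i → ℝ} (hq : ∀ i, Measurable (q i))
    (hqB : ∀ i, μ⟦y i ⁻¹' B i | 𝓖⟧ =ᵐ[μ] q i ∘ a i) (S : Finset ι) :
    μ.real (⋂ i ∈ S, a i ⁻¹' A i ∩ y i ⁻¹' B i) =
      ∏ i ∈ S, ∫ ω, (A i).indicator (q i) (a i ω) ∂μ := by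
  set U : Set Ω := ⋂ i ∈ S, a i ⁻¹' A i with hU
  set V : Set Ω := ⋂ i ∈ S, y i ⁻¹' B i with hV
  have hUm : MeasurableSet[𝓖] U := Finset.measurableSet_biInter S fun i _ => ha i (hA i)
  have hVm : MeasurableSet V := Finset.measurableSet_biInter S fun i _ => hy i (hB i)
  have hUV : ⋂ i ∈ S, a i ⁻¹' A i ∩ y i ⁻¹' B i = V ∩ U := by
    simp only [hU, hV, Set.iInter_inter_distrib, Set.inter_comm]
  have hcond : μ⟦V | 𝓖⟧ =ᵐ[μ] fun ω => ∏ i ∈ S, q i (a i ω) := by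
    have hqS : ∀ᵐ ω ∂μ, ∀ i ∈ S, (μ⟦y i ⁻¹' B i | 𝓖⟧) ω = q i (a i ω) :=
      (ae_ball_iff S.countable_toSet).2 fun i _ => hqB i
    filter_upwards [h S B fun i _ => hB i, hqS] with ω hprod hqS
    exact hprod.trans (Finset.prod_congr rfl hqS)
  calc μ.real (⋂ i ∈ S, a i ⁻¹' A i ∩ y i ⁻¹' B i)
      = ∫ ω in U, V.indicator (fun _ => (1 : ℝ)) ω ∂μ := by
        rw [hUV, integral_indicator_const _ hVm, measureReal_restrict_apply hVm, smul_eq_mul,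
          mul_one]
    _ = ∫ ω in U, (μ⟦V | 𝓖⟧) ω ∂μ :=
        (setIntegral_condExp hle ((integrable_const _).indicator hVm) hUm).symm
    _ = ∫ ω in U, ∏ i ∈ S, q i (a i ω) ∂μ := integral_congr_ae (ae_restrict_of_ae hcond)
    _ = ∫ ω, ∏ i ∈ S, (A i).indicator (q i) (a i ω) ∂μ := by
        rw [← integral_indicator (hle _ hUm), indicator_biInter_preimage_prod]
    _ = ∏ i ∈ S, ∫ ω, (A i).indicator (q i) (a i ω) ∂μ :=
        integral_finset_prod_comp_of_iIndepFun (fun i => (ha i).mono hle le_rfl) hindep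
          (fun i => (hq i).indicator (hA i)) S

theorem iIndepFun_prodMk_of_measure_biInter_inter (ha : ∀ i, Measurable (a i))
    (hy : ∀ i, Measurable (y i))
    (h : ∀ (A : ∀ i, Set (α i)) (B : ι → Set ℝ), (∀ i, MeasurableSet (A i)) →
      (∀ i, MeasurableSet (B i)) → ∀ S : Finset ι,
      μ.real (⋂ i ∈ S, a i ⁻¹' A i ∩ y i ⁻¹' B i) =
        ∏ i ∈ S, μ.real (a i ⁻¹' A i ∩ y i ⁻¹' B i)) :
    iIndepFun (fun i ω => (a i ω, y i ω)) μ := by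
  have hrect (i : ι) : MeasurableSpace.comap (fun ω => (a i ω, y i ω)) inferInstance =
      MeasurableSpace.generateFrom (Set.preimage (fun ω => (a i ω, y i ω)) ''
        Set.image2 (· ×ˢ ·) {A | MeasurableSet A} {B | MeasurableSet B}) := by
    rw [← MeasurableSpace.comap_generateFrom, generateFrom_prod]
  refine iIndepSets.iIndep (fun i => ((ha i).prodMk (hy i)).comap_le) _
    (fun i => isPiSystem_prod.comap _) hrect ((iIndepSets_iff _ _).2 fun S f hf => ?_)
  have hex (i : ι) : ∃ A : Set (α i), ∃ B : Set ℝ, MeasurableSet A ∧ MeasurableSet B ∧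
      (i ∈ S → f i = a i ⁻¹' A ∩ y i ⁻¹' B) := by
    by_cases hi : i ∈ S
    · obtain ⟨_, ⟨A, hA, B, hB, rfl⟩, hfi⟩ := hf i hi
      exact ⟨A, B, hA, hB, fun _ => hfi.symm⟩
    · exact ⟨∅, ∅, .empty, .empty, fun hi' => absurd hi' hi⟩
  choose A B hA hB hf using hex
  rw [Set.iInter₂_congr hf, Finset.prod_congr rfl fun i hi => congrArg μ (hf i hi),
    ← ENNReal.toReal_eq_toReal_iff' (measure_ne_top _ _)
      (ENNReal.prod_ne_top fun i _ => measure_ne_top _ _), ENNReal.toReal_prod]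
  exact h A B hA hB S

theorem CondIndepGiven.iIndepFun_prodMk (h : CondIndepGiven 𝓖 μ y) (hle : 𝓖 ≤ mΩ)
    (ha : ∀ i, Measurable[𝓖] (a i)) (hindep : iIndepFun a μ) (hy : ∀ i, Measurable (y i))
    (hcond : ∀ i, ∀ B : Set ℝ, MeasurableSet B →
      ∃ q : α i → ℝ, Measurable q ∧ μ⟦y i ⁻¹' B | 𝓖⟧ =ᵐ[μ] q ∘ a i) :
    iIndepFun (fun i ω => (a i ω, y i ω)) μ := by
  refine iIndepFun_prodMk_of_measure_biInter_inter (fun i => (ha i).mono hle le_rfl) hy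
    fun A B hA hB S => ?_
  choose q hq hqB using fun i => hcond i (B i) (hB i)
  have hprod := h.measureReal_biInter_inter hle ha hindep hy hA hB hq hqB
  have hsingle (i : ι) :
      μ.real (a i ⁻¹' A i ∩ y i ⁻¹' B i) = ∫ ω, (A i).indicator (q i) (a i ω) ∂μ := by
    simpa only [Finset.mem_singleton, Set.iInter_iInter_eq_left, Finset.prod_singleton]
      using hprod {i}
  simp only [hprod S, hsingle]

end ConditionalIndependence

section Correlation

variable {θ : ℝ → ℝ}

theorem integrable_of_correlation_pos (h : 0 < correlation θ) :
    Integrable (fun z => θ z * z) (gaussianReal 0 1) := by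
  by_contra hn
  rw [correlation, integral_undef hn] at h
  exact lt_irrefl _ h

theorem aemeasurable_of_correlation_pos (h : 0 < correlation θ) :
    AEMeasurable θ (gaussianReal 0 1) := by
  have := nullSingletonClass_gaussianReal (μ := 0) one_ne_zero
  have hdiv : AEMeasurable (fun z => θ z * z / z) (gaussianReal 0 1) :=
    (integrable_of_correlation_pos h).aestronglyMeasurable.aemeasurable.div aemeasurable_id
  refine hdiv.congr ?_
  filter_upwards [compl_mem_ae_iff.2 (measure_singleton (μ := gaussianReal 0 1) (0 : ℝ))] with z hz
  exact mul_div_cancel_right₀ _ hz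

variable {E : Type*} [NormedAddCommGroup E] [InnerProductSpace ℝ E] [FiniteDimensional ℝ E]
  [MeasurableSpace E] [BorelSpace E] {x : E}

theorem measurePreserving_inner_stdGaussian (hx : ‖x‖ = 1) :
    MeasurePreserving (fun g => inner ℝ g x) (stdGaussian E) (gaussianReal 0 1) where
  measurable := by fun_prop
  map_eq := by
    have hmap : (stdGaussian E).map (fun g => inner ℝ x g) =
        gaussianReal 0 (‖innerSL ℝ x‖ ^ 2).toNNReal := map_strongDual_stdGaussian (innerSL ℝ x)
    simpa only [innerSL_apply_norm, hx, one_pow, Real.toNNReal_one, real_inner_comm] using hmap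

-- The reflection in the line through `x` preserves the Gaussian measure, so it fixes the integral.
theorem integral_comp_inner_smul_stdGaussian (hx : ‖x‖ = 1) (hθ : AEMeasurable θ (gaussianReal 0 1))
    (hi : Integrable (fun g => θ (inner ℝ g x) • g) (stdGaussian E)) :
    ∫ g, θ (inner ℝ g x) • g ∂(stdGaussian E) = correlation θ • x := by
  set v := ∫ g, θ (inner ℝ g x) • g ∂(stdGaussian E)
  set R := (ℝ ∙ x).reflection
  have hRx : R x = x :=
    Submodule.reflection_mem_subspace_eq_self (Submodule.mem_span_singleton_self x)
  have hRinner (g : E) : inner ℝ (R g) x = inner ℝ g x := by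
    rw [← R.inner_map_map g x, hRx]
  have hfixed : R v = v := by
    calc R v = ∫ g, R (θ (inner ℝ g x) • g) ∂(stdGaussian E) :=
          (R.toContinuousLinearEquiv.integral_comp_comm _).symm
      _ = ∫ g, θ (inner ℝ (R g) x) • R g ∂(stdGaussian E) := by
          simp only [map_smul, hRinner]
      _ = ∫ g, θ (inner ℝ g x) • g ∂(stdGaussian E).map R :=
          (integral_map_equiv R.toMeasurableEquiv fun g => θ (inner ℝ g x) • g).symm
      _ = v := by rw [stdGaussian_map R]
  have hline : v = inner ℝ x v • x := by
    rw [← Submodule.starProjection_unit_singleton ℝ hx, eq_comm,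
      Submodule.starProjection_eq_self_iff]
    exact (Submodule.reflection_eq_self_iff v).1 hfixed
  have hcorr : inner ℝ x v = correlation θ := by
    calc inner ℝ x v = ∫ g, inner ℝ x (θ (inner ℝ g x) • g) ∂(stdGaussian E) :=
          (integral_inner hi x).symm
      _ = ∫ g, θ (inner ℝ g x) * inner ℝ g x ∂(stdGaussian E) := by
          simp only [real_inner_smul_right, real_inner_comm]
      _ = correlation θ :=
          (measurePreserving_inner_stdGaussian hx).hasLaw.integral_comp
            (f := fun z => θ z * z) (hθ.mul aemeasurable_id).aestronglyMeasurable
  rw [hline, hcorr]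

end Correlation

section SignValued

variable {Ω : Type*} {𝓖 mΩ : MeasurableSpace Ω} {μ : Measure Ω} [IsProbabilityMeasure μ]
  {Y : Ω → ℝ}

-- On `{-1, 1}` every indicator function is affine.
theorem condExp_preimage_eq_affine_of_sign_valued (hle : 𝓖 ≤ mΩ) (hY : Integrable Y μ)
    (hsign : ∀ᵐ ω ∂μ, Y ω = -1 ∨ Y ω = 1) (B : Set ℝ) :
    ∃ α β : ℝ, μ⟦Y ⁻¹' B | 𝓖⟧ =ᵐ[μ] fun ω => α + β * (μ[Y | 𝓖]) ω := by
  set p : ℝ := B.indicator 1 1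
  set q : ℝ := B.indicator 1 (-1)
  have haffine : (Y ⁻¹' B).indicator (fun _ => (1 : ℝ)) =ᵐ[μ]
      (fun _ => (p + q) / 2) + ((p - q) / 2) • Y := by
    filter_upwards [hsign] with ω h
    have hind : (Y ⁻¹' B).indicator (fun _ => (1 : ℝ)) ω = B.indicator 1 (Y ω) := rfl
    simp only [hind, Pi.add_apply, Pi.smul_apply, smul_eq_mul]
    rcases h with h | h <;> rw [h] <;> ring
  refine ⟨(p + q) / 2, (p - q) / 2, (condExp_congr_ae haffine).trans ?_⟩
  filter_upwards [condExp_add (m := 𝓖) (integrable_const (μ := μ) ((p + q) / 2))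
    (hY.smul ((p - q) / 2)), condExp_smul (μ := μ) ((p - q) / 2) Y 𝓖] with ω hadd hsmul
  rw [hadd, Pi.add_apply, hsmul, condExp_const hle, Pi.smul_apply, smul_eq_mul]

end SignValued

section Model

variable {Ω : Type*} {n m : ℕ} {a : Fin m → Ω → EuclideanSpace ℝ (Fin n)}

theorem measurable_sigmaOf (i : Fin m) : Measurable[sigmaOf a] (a i) :=
  (measurable_pi_apply i).comp (comap_measurable fun ω i => a i ω)

variable [MeasurableSpace Ω] {μ : Measure Ω} {y : Fin m → Ω → ℝ} {θ : ℝ → ℝ}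
  {x : EuclideanSpace ℝ (Fin n)}

theorem sigmaOf_le (ha : ∀ i, Measurable (a i)) : sigmaOf a ≤ ‹MeasurableSpace Ω› :=
  (measurable_pi_lambda _ ha).comap_le

namespace OneBitModel

theorem measurable_smul (H : OneBitModel μ a y θ x) (i : Fin m) :
    Measurable fun ω => y i ω • a i ω :=
  (H.measurable_y i).smul (H.measurable_a i)

theorem eq_or_eq_neg (H : OneBitModel μ a y θ x) (i : Fin m) :
    ∀ᵐ ω ∂μ, y i ω • a i ω = a i ω ∨ y i ω • a i ω = -a i ω := by
  filter_upwards [H.sign_valued i] with ω h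
  rcases h with h | h
  · exact .inr (by rw [h, neg_one_smul])
  · exact .inl (by rw [h, one_smul])

theorem measurePreserving (H : OneBitModel μ a y θ x) (i : Fin m) :
    MeasurePreserving (a i) μ (stdGaussian (EuclideanSpace ℝ (Fin n))) :=
  (H.gaussian i).measurePreserving (H.measurable_a i)

theorem integrable_smul (H : OneBitModel μ a y θ x) (i : Fin m) :
    Integrable (fun ω => y i ω • a i ω) μ := by
  have ha : Integrable (a i) μ :=
    ((H.measurePreserving i).integrable_comp aestronglyMeasurable_id).2 IsGaussian.integrable_id
  refine ha.mono (H.measurable_smul i).aestronglyMeasurable ?_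
  filter_upwards [H.eq_or_eq_neg i] with ω h
  rcases h with h | h <;> simp only [h, norm_neg, le_refl]

variable [IsProbabilityMeasure μ]

theorem integrable_y (H : OneBitModel μ a y θ x) (i : Fin m) : Integrable (y i) μ := by
  refine (integrable_const (1 : ℝ)).mono (H.measurable_y i).aestronglyMeasurable ?_
  filter_upwards [H.sign_valued i] with ω h
  rcases h with h | h <;> simp only [h, norm_neg, le_refl]

theorem exists_condProb_eq_comp (H : OneBitModel μ a y θ x) (hx : ‖x‖ = 1)
    (hθ : AEMeasurable θ (gaussianReal 0 1)) (i : Fin m) (B : Set ℝ) :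
    ∃ q : EuclideanSpace ℝ (Fin n) → ℝ, Measurable q ∧
      μ⟦y i ⁻¹' B | sigmaOf a⟧ =ᵐ[μ] q ∘ a i := by
  obtain ⟨α, β, haffine⟩ := condExp_preimage_eq_affine_of_sign_valued
    (sigmaOf_le H.measurable_a) (H.integrable_y i) (H.sign_valued i) B
  have hθ_eq : ∀ᵐ ω ∂μ, θ (inner ℝ (a i ω) x) = hθ.mk θ (inner ℝ (a i ω) x) :=
    ((measurePreserving_inner_stdGaussian hx).comp
      (H.measurePreserving i)).quasiMeasurePreserving.ae hθ.ae_eq_mk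
  have := hθ.measurable_mk
  refine ⟨fun v => α + β * hθ.mk θ (inner ℝ v x), by fun_prop, ?_⟩
  filter_upwards [haffine, H.condMean i, hθ_eq] with ω hprob hmean hmk
  rw [hprob, hmean, hmk, Function.comp_apply]

theorem iIndepFun_smul (H : OneBitModel μ a y θ x) (hx : ‖x‖ = 1)
    (hθ : AEMeasurable θ (gaussianReal 0 1)) : iIndepFun (fun i ω => y i ω • a i ω) μ := by
  have hpair : iIndepFun (fun i ω => (a i ω, y i ω)) μ :=
    H.condIndep.iIndepFun_prodMk (sigmaOf_le H.measurable_a) measurable_sigmaOf H.indep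
      H.measurable_y fun i B _ => H.exists_condProb_eq_comp hx hθ i B
  exact hpair.comp (fun _ p => p.2 • p.1) fun _ => measurable_snd.smul measurable_fst

theorem integral_smul (H : OneBitModel μ a y θ x) (hx : ‖x‖ = 1)
    (hθ : AEMeasurable θ (gaussianReal 0 1)) (i : Fin m) :
    ∫ ω, y i ω • a i ω ∂μ = correlation θ • x := by
  have hcond : μ[y i • a i | sigmaOf a] =ᵐ[μ] fun ω => θ (inner ℝ (a i ω) x) • a i ω := by
    filter_upwards [condExp_smul_of_aestronglyMeasurable_right (H.integrable_y i)
      (H.integrable_smul i) (measurable_sigmaOf i).aestronglyMeasurable,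
      H.condMean i] with ω hpull hmean
    rw [hpull, Pi.smul_apply', hmean]
  have hmeas : AEStronglyMeasurable (fun g => θ (inner ℝ g x) • g)
      (stdGaussian (EuclideanSpace ℝ (Fin n))) := by
    have hθx := hθ.comp_quasiMeasurePreserving
      (measurePreserving_inner_stdGaussian hx).quasiMeasurePreserving
    exact (hθx.smul aemeasurable_id).aestronglyMeasurable
  have hint : Integrable (fun g => θ (inner ℝ g x) • g)
      (stdGaussian (EuclideanSpace ℝ (Fin n))) :=
    ((H.measurePreserving i).integrable_comp hmeas).1 (integrable_condExp.congr hcond)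
  calc ∫ ω, y i ω • a i ω ∂μ
      = ∫ ω, (μ[y i • a i | sigmaOf a]) ω ∂μ :=
        (integral_condExp (sigmaOf_le H.measurable_a)).symm
    _ = ∫ ω, θ (inner ℝ (a i ω) x) • a i ω ∂μ := integral_congr_ae hcond
    _ = ∫ g, θ (inner ℝ g x) • g ∂(stdGaussian (EuclideanSpace ℝ (Fin n))) :=
        (H.gaussian i).integral_comp hmeas
    _ = correlation θ • x := integral_comp_inner_smul_stdGaussian hx hθ hint

end OneBitModel

end Model

section Deviation

variable {n m : ℕ} {K : Set (EuclideanSpace ℝ (Fin n))} {x : EuclideanSpace ℝ (Fin n)}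

theorem lipschitzWith_supportFunction_sub_self (hK : K ⊆ Metric.closedBall 0 1)
    (hne : K.Nonempty) : LipschitzWith 2 (supportFunction (K - K)) :=
  lipschitzWith_supportFunction (hne.sub hne)
    (by simpa only [NNReal.coe_ofNat, mul_one] using sub_self_subset_closedBall hK)

theorem integral_supportFunction_smul {c : ℝ} (hc : 0 ≤ c) :
    ∫ g, supportFunction (K - K) (c • g) ∂stdGaussian _ = c * meanWidth K := by
  simp_rw [supportFunction_smul hc, integral_const_mul]
  rfl

variable {Ω : Type*} [MeasurableSpace Ω] {μ : Measure Ω} {a : Fin m → Ω → EuclideanSpace ℝ (Fin n)}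
  {y : Fin m → Ω → ℝ} {θ : ℝ → ℝ}

theorem OneBitModel.measurable_sum_sub (H : OneBitModel μ a y θ x) (z : EuclideanSpace ℝ (Fin n)) :
    Measurable fun ω => ∑ i, (y i ω • a i ω - z) :=
  Finset.measurable_sum _ fun i _ => (H.measurable_smul i).sub_const z

theorem OneBitModel.measurable_supportFunction_sum_sub (H : OneBitModel μ a y θ x)
    (hK : K ⊆ Metric.closedBall 0 1) (hne : K.Nonempty) (z : EuclideanSpace ℝ (Fin n)) :
    Measurable fun ω => supportFunction (K - K) (∑ i, (y i ω • a i ω - z)) :=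
  (lipschitzWith_supportFunction_sub_self hK hne).continuous.measurable.comp
    (H.measurable_sum_sub z)

variable [IsProbabilityMeasure μ]

theorem OneBitModel.convexDominated_map_sum_sub (H : OneBitModel μ a y θ x) (hx : ‖x‖ = 1)
    (hθ : AEMeasurable θ (gaussianReal 0 1)) :
    ConvexDominated (μ.map fun ω => ∑ i, (y i ω • a i ω - correlation θ • x))
      ((stdGaussian (EuclideanSpace ℝ (Fin n))).map ((2 * √m) • ·)) := by
  have hdom (i : Fin m) : ConvexDominated (μ.map fun ω => y i ω • a i ω - correlation θ • x)
      ((stdGaussian (EuclideanSpace ℝ (Fin n))).map ((2 : ℝ) • ·)) := by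
    simpa only [H.integral_smul hx hθ] using
      convexDominated_map_sub_integral (H.integrable_smul i) (H.gaussian i) (H.eq_or_eq_neg i)
  have hindep : iIndepFun (fun i ω => y i ω • a i ω - correlation θ • x) μ :=
    (H.iIndepFun_smul hx hθ).comp (fun _ v => v - correlation θ • x) fun _ => by fun_prop
  have hsum := convexDominated_map_sum (fun i => (H.measurable_smul i).sub_const _) hindep hdom
    Finset.univ
  have hscale : √(∑ _i : Fin m, (2 : ℝ) ^ 2) = 2 * √m := by
    rw [Finset.sum_const, Finset.card_univ, Fintype.card_fin, nsmul_eq_mul, mul_comm,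
      Real.sqrt_mul (sq_nonneg 2), Real.sqrt_sq zero_le_two]
  simpa only [hscale, Finset.sum_fn] using hsum

theorem OneBitModel.measureReal_supportFunction_ge_le (H : OneBitModel μ a y θ x)
    (hK : K ⊆ Metric.closedBall 0 1) (hne : K.Nonempty) (hx : ‖x‖ = 1)
    (hθ : AEMeasurable θ (gaussianReal 0 1)) {u : ℝ} (hu : 0 ≤ u) :
    μ.real {ω | 2 * √m * meanWidth K + u ≤
        supportFunction (K - K) (∑ i, (y i ω • a i ω - correlation θ • x))} ≤
      Real.exp (-(u ^ 2 / (8 * Real.pi ^ 2 * m))) := by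
  have hbdd : Bornology.IsBounded (K - K) :=
    Metric.isBounded_closedBall.subset (sub_self_subset_closedBall hK)
  have htail := measureReal_ge_le_of_convexDominated (H.measurable_sum_sub _).aemeasurable
    (H.convexDominated_map_sum_sub hx hθ) (lipschitzWith_supportFunction_sub_self hK hne)
    (convexOn_supportFunction (hne.sub hne) hbdd) hu
  rw [integral_supportFunction_smul (by positivity)] at htail
  refine htail.trans_eq ?_
  rw [NNReal.coe_ofNat, mul_pow, mul_pow, mul_pow, Real.sq_sqrt m.cast_nonneg]
  ring_nf

end Deviation

theorem norm_sub_sq_le_of_norm_le_one {E : Type*} [NormedAddCommGroup E] [InnerProductSpace ℝ E]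
    {u v : E} (hu : ‖u‖ ≤ 1) (hv : ‖v‖ ≤ 1) : ‖u - v‖ ^ 2 ≤ 2 * (1 - inner ℝ u v) := by
  rw [norm_sub_sq_real]
  linarith [pow_le_one₀ (n := 2) (norm_nonneg u) hu, pow_le_one₀ (n := 2) (norm_nonneg v) hv]

section Recovery

variable {n m : ℕ} {K : Set (EuclideanSpace ℝ (Fin n))}

theorem IsSolution.inner_sum_nonneg {x xhat : EuclideanSpace ℝ (Fin n)} {b : Fin m → ℝ}
    {v : Fin m → EuclideanSpace ℝ (Fin n)} (h : IsSolution K v b xhat) (hxK : x ∈ K) :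
    0 ≤ inner ℝ (∑ i, b i • v i) (xhat - x) := by
  simp only [inner_sub_right, sum_inner, real_inner_smul_left, sub_nonneg]
  exact h.2 x hxK

theorem IsSolution.norm_sub_sq_le {x xhat : EuclideanSpace ℝ (Fin n)} {b : Fin m → ℝ}
    {v : Fin m → EuclideanSpace ℝ (Fin n)} {l δ : ℝ} (h : IsSolution K v b xhat) (hm : 0 < m)
    (hl : 0 < l) (hK : K ⊆ Metric.closedBall 0 1) (hxK : x ∈ K) (hx : ‖x‖ = 1)
    (hdev : supportFunction (K - K) (∑ i, (b i • v i - l • x)) ≤ m * δ / 2) :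
    ‖xhat - x‖ ^ 2 ≤ δ / l := by
  have hbdd : Bornology.IsBounded (K - K) :=
    Metric.isBounded_closedBall.subset (sub_self_subset_closedBall hK)
  have hinner : inner ℝ (∑ i, (b i • v i - l • x)) (xhat - x) ≤ m * δ / 2 :=
    (inner_le_supportFunction hbdd _ (Set.sub_mem_sub h.1 hxK)).trans hdev
  have hsplit : inner ℝ (∑ i, (b i • v i - l • x)) (xhat - x) =
      inner ℝ (∑ i, b i • v i) (xhat - x) + m * (l * (1 - inner ℝ xhat x)) := by
    rw [Finset.sum_sub_distrib, inner_sub_left, Finset.sum_const, Finset.card_univ,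
      Fintype.card_fin, ← Nat.cast_smul_eq_nsmul ℝ, real_inner_smul_left, real_inner_smul_left,
      inner_sub_right x, real_inner_self_eq_norm_sq, hx, real_inner_comm xhat x]
    ring
  have hgap : l * (1 - inner ℝ xhat x) ≤ δ / 2 := by
    refine le_of_mul_le_mul_left ?_ (Nat.cast_pos (α := ℝ).2 hm)
    linarith [h.inner_sum_nonneg hxK]
  have hnorm := norm_sub_sq_le_of_norm_le_one (mem_closedBall_zero_iff.1 (hK h.1)) hx.le
  rw [le_div_iff₀' hl]
  linarith [mul_le_mul_of_nonneg_left hnorm hl.le]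

theorem two_mul_sqrt_mul_add_le_of_sq_le {m δ w : ℝ} (hm : 0 ≤ m) (hδ : 0 < δ)
    (h : 64 * (δ ^ 2)⁻¹ * w ^ 2 ≤ m) : 2 * √m * w + m * δ / 4 ≤ m * δ / 2 := by
  have hsq : (8 * w) ^ 2 ≤ (δ * √m) ^ 2 := by
    have hw : δ ^ 2 * (64 * (δ ^ 2)⁻¹ * w ^ 2) = (8 * w) ^ 2 := by
      field_simp
      ring
    rw [mul_pow δ, Real.sq_sqrt hm, ← hw]
    gcongr
  have hw : 8 * w ≤ δ * √m := le_of_sq_le_sq hsq (by positivity)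
  calc 2 * √m * w + m * δ / 4 = √m * (8 * w) / 4 + m * δ / 4 := by ring
    _ ≤ √m * (δ * √m) / 4 + m * δ / 4 := by gcongr
    _ = m * δ / 2 := by
      rw [mul_left_comm, Real.mul_self_sqrt hm]
      ring

variable {Ω : Type*} [MeasurableSpace Ω] {μ : Measure Ω} [IsProbabilityMeasure μ]
  {a : Fin m → Ω → EuclideanSpace ℝ (Fin n)} {y : Fin m → Ω → ℝ} {θ : ℝ → ℝ}
  {x : EuclideanSpace ℝ (Fin n)}

theorem OneBitModel.one_sub_exp_le_measureReal (H : OneBitModel μ a y θ x)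
    (hK : K ⊆ Metric.closedBall 0 1) (hne : K.Nonempty) (hx : ‖x‖ = 1)
    (hθ : AEMeasurable θ (gaussianReal 0 1)) {δ : ℝ} (hδ : 0 < δ)
    (hwm : 64 * (δ ^ 2)⁻¹ * meanWidth K ^ 2 ≤ m) :
    1 - Real.exp (-(1 / (128 * Real.pi ^ 2) * δ ^ 2 * m)) ≤
      μ.real {ω | supportFunction (K - K) (∑ i, (y i ω • a i ω - correlation θ • x)) ≤
        m * δ / 2} := by
  set S : Ω → ℝ := fun ω => supportFunction (K - K) (∑ i, (y i ω • a i ω - correlation θ • x))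
  set t := 2 * √m * meanWidth K + m * δ / 4
  have hmeas : MeasurableSet {ω | t ≤ S ω} :=
    measurableSet_le measurable_const (H.measurable_supportFunction_sum_sub hK hne _)
  have hsubset : {ω | t ≤ S ω}ᶜ ⊆ {ω | S ω ≤ m * δ / 2} := fun ω (hω : ¬t ≤ S ω) =>
    (not_le.1 hω).le.trans (two_mul_sqrt_mul_add_le_of_sq_le m.cast_nonneg hδ hwm)
  have htail : μ.real {ω | t ≤ S ω} ≤ Real.exp (-(1 / (128 * Real.pi ^ 2) * δ ^ 2 * m)) := by
    refine (H.measureReal_supportFunction_ge_le hK hne hx hθ (by positivity)).trans_eq ?_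
    congr 2
    field_simp
    ring
  calc 1 - Real.exp (-(1 / (128 * Real.pi ^ 2) * δ ^ 2 * m))
      ≤ 1 - μ.real {ω | t ≤ S ω} := sub_le_sub_left htail 1
    _ = μ.real {ω | t ≤ S ω}ᶜ := (probReal_compl_eq_one_sub hmeas).symm
    _ ≤ μ.real {ω | S ω ≤ m * δ / 2} := measureReal_mono hsubset

end Recovery

theorem corollary1 :
    ∃ C c : ℝ, 0 < C ∧ 0 < c ∧
      ∀ (n m : ℕ) (Ω : Type*) [MeasurableSpace Ω] (μ : Measure Ω) [IsProbabilityMeasure μ]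
        (K : Set (EuclideanSpace ℝ (Fin n))) (x : EuclideanSpace ℝ (Fin n)) (θ : ℝ → ℝ)
        (a : Fin m → Ω → EuclideanSpace ℝ (Fin n)) (y : Fin m → Ω → ℝ) (δ : ℝ),
        K ⊆ Metric.closedBall 0 1 →
        x ∈ K →
        ‖x‖ = 1 →
        OneBitModel μ a y θ x →
        0 < correlation θ →
        0 < δ →
        C * (δ ^ 2)⁻¹ * meanWidth K ^ 2 ≤ (m : ℝ) →
        ∃ E : Set Ω, MeasurableSet E ∧
          1 - 8 * Real.exp (-(c * δ ^ 2 * (m : ℝ))) ≤ μ.real E ∧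
          ∀ ω ∈ E, ∀ xhat : EuclideanSpace ℝ (Fin n),
            IsSolution K (fun i => a i ω) (fun i => y i ω) xhat →
              ‖xhat - x‖ ^ 2 ≤ δ / correlation θ := by
  refine ⟨64, 1 / (128 * Real.pi ^ 2), by positivity, by positivity, ?_⟩
  intro n m Ω _ μ _ K x θ a y δ hK hxK hx H hcorr hδ hwm
  rcases Nat.eq_zero_or_pos m with rfl | hm
  · exact ⟨∅, .empty, by norm_num, by simp⟩
  have hne : K.Nonempty := ⟨x, hxK⟩
  refine ⟨{ω | supportFunction (K - K) (∑ i, (y i ω • a i ω - correlation θ • x)) ≤ m * δ / 2},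
    measurableSet_le (H.measurable_supportFunction_sum_sub hK hne _) measurable_const, ?_,
    fun ω hω xhat hsol => hsol.norm_sub_sq_le hm hcorr hK hxK hx hω⟩
  calc 1 - 8 * Real.exp (-(1 / (128 * Real.pi ^ 2) * δ ^ 2 * m))
      ≤ 1 - Real.exp (-(1 / (128 * Real.pi ^ 2) * δ ^ 2 * m)) :=
        sub_le_sub_left (le_mul_of_one_le_left (Real.exp_pos _).le (by norm_num)) 1
    _ ≤ _ := H.one_sub_exp_le_measureReal hK hne hx (aemeasurable_of_correlation_pos hcorr) hδ hwm
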